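/- For a group $H$ let $\mathbb{Q}/\mathbb{Z}$ carry the trivial $H$-action and let $$\mathrm{Sha}^2(H,\mathbb{Q}/\mathbb{Z})=\bigcap_{A\le H,\ A\text{ abelian}}\ker\bigl(\mathrm{res}^H_A: H^2(H,\mathbb{Q}/\mathbb{Z})\to H^2(A,\mathbb{Q}/\mathbb{Z})\bigr)$$ denote its Bogomolov multiplier. If $Q$ is a normal subgroup of a group $G$, then $G$ acts on $H^2(Q,\mathbb{Q}/\mathbb{Z})$ from the right: for $g\in G$ and the class $\alpha$ of a $2$-cocycle $c$, $\alpha g$ is the class of the cocycle $(x,y)\mapsto c(gxg^{-1},gyg^{-1})$; this action preserves $\mathrm{Sha}^2(Q,\mathbb{Q}/\mathbb{Z})$. For a subgroup $K\le G$ let $[\mathrm{Sha}^2(Q,\mathbb{Q}/\mathbb{Z}),K]$ be the subgroup generated by all elements $\alpha g-\alpha$ with $\alpha\in \mathrm{Sha}^2(Q,\mathbb{Q}/\mathbb{Z})$ and $g\in K$. Let $p$ be a prime, let $G$ be a finite group, and let $P$ be a Sylow $p$-subgroup of $G$ whose nilpotency class is at most $p$. Let $Q$ be a normal subgroup of $G$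 which is a $p$-group. Then $$[\mathrm{Sha}^2(Q,\mathbb{Q}/\mathbb{Z}),G]=[\mathrm{Sha}^2(Q,\mathbb{Q}/\mathbb{Z}),N_G(P)].$$ -/

import Mathlib

open CategoryTheory

universe u

namespace BogomolovMultiplier

/-- The subgroup `Шⁿ(G, M)` of `Hⁿ(G, M)`: the intersection, over all abelian subgroups `A ≤ G`,
of the kernels of the restriction maps `Hⁿ(G, M) → Hⁿ(A, M)`. -/
noncomputable def sha {k G : Type u} [CommRing k] [Group G] (M : Rep.{u} k G) (n : ℕ) :
    Submodule k (groupCohomology M n) :=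
  ⨅ (A : Subgroup G) (_ : IsMulCommutative A),
    LinearMap.ker (groupCohomology.map A.subtype (𝟙 (Rep.res A.subtype M)) n).hom

/-- `ℚ/ℤ` with the trivial action of `G`. The lifts only put the ring `ℤ` and the group `ℚ/ℤ` into
the universe of `G`. -/
noncomputable abbrev ratModInt (G : Type u) [Group G] : Rep.{u} (ULift.{u} ℤ) G :=
  Rep.trivial (ULift.{u} ℤ) G (ULift.{u} (AddCircle (1 : ℚ)))

/-- For a normal subgroup `Q` of `G` and `g : G`, the map `α ↦ α g` on `H²(Q, ℚ/ℤ)`: it sends the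
class of a cocycle `c` to the class of `(x, y) ↦ c (g x g⁻¹, g y g⁻¹)`. -/
noncomputable def conj {G : Type u} [Group G] (Q : Subgroup G) [Q.Normal] (g : G) :
    groupCohomology (ratModInt Q) 2 →ₗ[ULift.{u} ℤ] groupCohomology (ratModInt Q) 2 :=
  (groupCohomology.map (A := ratModInt Q) (B := ratModInt Q)
    (MulAut.conjNormal g : MulAut Q).toMonoidHom (𝟙 (ratModInt Q)) 2).hom

/-- `[Ш²(Q, ℚ/ℤ), K]` for a normal subgroup `Q` of `G` and a subgroup `K` of `G`: the subgroup of
`H²(Q, ℚ/ℤ)` generated by all `α g - α` with `α ∈ Ш²(Q, ℚ/ℤ)` and `g ∈ K`. -/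
noncomputable def shaCommutator {G : Type u} [Group G] (Q : Subgroup G) [Q.Normal]
    (K : Subgroup G) : AddSubgroup (groupCohomology (ratModInt Q) 2) :=
  AddSubgroup.closure {β | ∃ α ∈ sha (ratModInt Q) 2, ∃ g ∈ K, β = conj Q g α - α}

end BogomolovMultiplier

/-! The proof has two halves. First, `(x - 1) ^ (p - 1) = 0` on Ш²(Q) for all `x ∈ P`
(`conjSha_sub_one_pow_eq_zero`). Inflate a cocycle `c` along `π : F → Q` with `F` free on `Q`; it
becomes the coboundary of some `s`. By Hopf, `c` is a coboundary once `s - s 1` vanishes on `ker π ∩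
[F, F]`. For `c` in Ш² it vanishes on `⁅u, v⁆` whenever `π u` and `π v` commute. Filter `[F, F]` by
commutators of preimages of the lower central series of `P`. Each factor `x - 1` moves one step
down, and after `p - 1` steps the class bound makes the generators commute in `Q`. Second, such a
bound forces `[V, G] = [V, N_G(P)]` for a module `V` of exponent a power of `p`
(`Sylow.sub_mem_closure_of_normalizer`). Dually, let `w` be fixed by `N_G(P)` and, by induction, `p
• w` by `G`. Then `gP ↦ g w - w` (with `gP` the conjugate Sylow subgroup) is `P`-equivariant with
`p`-torsion values. Since `1 + x + ... + x ^ (p - 1)` is `(x - 1) ^ (p - 1)` modulo `p`, nontrivial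
`P`-orbits contribute nothing. Hence the sum of all conjugates of `w` is `n • w`, where `n` is the
number of Sylow subgroups; as `n` is prime to `p`, `w` is fixed by `G`. -/

/-! ### Fixed points of Sylow normalizers. -/

open Finset in
/-- If `σ` permutes `Z` in cycles of prime length `p` and `f` sums to zero over each cycle, then
`f` sums to zero over `Z`. -/
theorem sum_eq_zero_of_iterate_prime {Y U : Type*} [AddCommGroup U] {p : ℕ} [Fact p.Prime]
    (σ : Y → Y) (f : Y → U) (Z : Finset Y) (hσ : ∀ z ∈ Z, σ z ∈ Z)
    (hp : ∀ z ∈ Z, σ^[p] z = z) (hne : ∀ z ∈ Z, σ z ≠ z)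
    (hsum : ∀ z ∈ Z, ∑ i ∈ range p, f (σ^[i] z) = 0) : ∑ z ∈ Z, f z = 0 := by
  classical
  induction Z using Finset.strongInduction with
  | H Z ih =>
    obtain rfl | ⟨z, hz⟩ := Z.eq_empty_or_nonempty
    · simp
    have hpos : 0 < p := (Fact.out : p.Prime).pos
    have hper : Function.minimalPeriod σ z = p :=
      Function.minimalPeriod_eq_prime (hp z hz) (hne z hz)
    have hmem : ∀ i, σ^[i] z ∈ Z := fun i => by
      induction i with
      | zero => exact hz
      | succ i hi => rw [Function.iterate_succ_apply']; exact hσ _ hi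
    set O := (range p).image (fun i => σ^[i] z) with hO
    have hOZ : O ⊆ Z := by
      intro y hy
      obtain ⟨i, -, rfl⟩ := mem_image.1 hy
      exact hmem i
    have hOmem : ∀ i, σ^[i] z ∈ O := fun i => by
      refine mem_image.2 ⟨i % p, mem_range.2 (Nat.mod_lt _ hpos), ?_⟩
      exact Function.IsPeriodicPt.iterate_mod_apply (hp z hz) i
    have hinj : Set.InjOn (fun i => σ^[i] z) (range p : Set ℕ) := by
      intro i hi j hj hij
      have := Function.iterate_injOn_Iio_minimalPeriod (f := σ) (x := z)
      rw [hper] at this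
      exact this (by simpa using hi) (by simpa using hj) hij
    have hsumO : ∑ y ∈ O, f y = 0 := by
      rw [hO, sum_image hinj]
      exact hsum z hz
    have hrest : ∑ y ∈ Z \ O, f y = 0 := by
      refine ih (Z \ O) ?_ ?_ ?_ ?_ ?_
      · exact sdiff_ssubset hOZ ⟨z, hOmem 0⟩
      · intro y hy
        obtain ⟨hyZ, hyO⟩ := mem_sdiff.1 hy
        refine mem_sdiff.2 ⟨hσ y hyZ, fun h => hyO ?_⟩
        obtain ⟨i, -, hi⟩ := mem_image.1 h
        have : y = σ^[p - 1 + i] z := by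
          rw [Function.iterate_add_apply, hi, ← Function.iterate_succ_apply,
            Nat.succ_eq_add_one, Nat.sub_add_cancel hpos, hp y hyZ]
        rw [this]
        exact hOmem _
      · exact fun y hy => hp y (mem_sdiff.1 hy).1
      · exact fun y hy => hne y (mem_sdiff.1 hy).1
      · exact fun y hy => hsum y (mem_sdiff.1 hy).1
    rw [← sum_sdiff hOZ, hrest, hsumO, add_zero]

-- Over `ZMod p`, both sides times `X - 1` equal `X ^ p - 1` by Frobenius.
open Polynomial in
theorem exists_geom_sum_eq_sub_one_pow_add (p : ℕ) [Fact p.Prime] :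
    ∃ q : ℤ[X], ∑ i ∈ Finset.range p, (X : ℤ[X]) ^ i = (X - 1) ^ (p - 1) + C (p : ℤ) * q := by
  have hpos : 0 < p := (Fact.out : p.Prime).pos
  have h : (∑ i ∈ Finset.range p, (X : (ZMod p)[X]) ^ i) = (X - 1) ^ (p - 1) := by
    have h1 : (X - 1 : (ZMod p)[X]) ≠ 0 := by
      simpa using X_sub_C_ne_zero (1 : ZMod p)
    apply mul_right_cancel₀ h1
    rw [geom_sum_mul, ← pow_succ, Nat.sub_add_cancel hpos, sub_pow_char, one_pow]
  have hd : C (p : ℤ) ∣ (∑ i ∈ Finset.range p, (X : ℤ[X]) ^ i) - (X - 1) ^ (p - 1) := by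
    rw [C_dvd_iff_dvd_coeff]
    intro i
    rw [← ZMod.intCast_zmod_eq_zero_iff_dvd, ← eq_intCast (Int.castRingHom (ZMod p)), ← coeff_map]
    simp [Polynomial.map_sum, h]
  obtain ⟨q, hq⟩ := hd
  exact ⟨q, by rw [← hq]; ring⟩

theorem geom_sum_apply_eq_zero {U : Type*} [AddCommGroup U] {p : ℕ} [Fact p.Prime]
    (T : AddMonoid.End U) (hT : (T - 1) ^ (p - 1) = 0) (v : U) (hv : p • v = 0) :
    ∑ i ∈ Finset.range p, (T ^ i) v = 0 := by
  obtain ⟨q, hq⟩ := exists_geom_sum_eq_sub_one_pow_add p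
  have h := congrArg (Polynomial.aeval T) hq
  simp only [map_sum, map_pow, Polynomial.aeval_X, map_add, map_sub, map_one, hT, zero_add,
    map_mul, map_natCast] at h
  have h2 := DFunLike.congr_fun h v
  rw [(Nat.cast_commute p (Polynomial.aeval T q)).eq] at h2
  have hsum : ∀ n, (∑ i ∈ Finset.range n, T ^ i) v = ∑ i ∈ Finset.range n, (T ^ i) v := fun n => by
    induction n with
    | zero => rfl
    | succ n ih => rw [Finset.sum_range_succ, Finset.sum_range_succ, ← ih]; rfl
  rw [hsum] at h2
  rw [h2]
  change (Polynomial.aeval T q) ((p : AddMonoid.End U) v) = 0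
  rw [AddMonoid.End.natCast_apply, hv, map_zero]

open scoped Classical in
/-- Let a finite `p`-group `P` act on a finite set `Y` and on an abelian group `U` such that
`(x - 1) ^ (p - 1) = 0` on `U` for all `x ∈ P`. Then the values of an equivariant map from `Y` to
the `p`-torsion of `U` add up to the sum of its values at the fixed points. -/
theorem IsPGroup.sum_eq_sum_fixedPoints {P Y U : Type*} [Group P] [Finite P] [Fintype Y]
    [AddCommGroup U] [MulAction P Y] {p : ℕ} [Fact p.Prime] (hP : IsPGroup p P)
    (ρ : P →* AddMonoid.End U) (hρ : ∀ x, (ρ x - 1) ^ (p - 1) = 0)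
    (f : Y → U) (hf : ∀ x y, f (x • y) = ρ x (f y)) (hpf : ∀ y, p • f y = 0) :
    ∑ y, f y = ∑ y with ∀ x : P, x • y = y, f y := by
  -- Climb a chain of subgroups, each normal of index `p` in the next.
  have key : ∀ (n : ℕ) (H : Subgroup P), Nat.card H = p ^ n →
      ∑ y, f y = ∑ y with ∀ x ∈ H, x • y = y, f y := by
    intro n
    induction n with
    | zero =>
      intro H hH
      rw [pow_zero, Subgroup.card_eq_one] at hH
      subst hH
      simp
    | succ n ih =>
      intro H hH
      have hprime : p.Prime := Fact.out
      obtain ⟨M, hMc, hMH⟩ : ∃ M ≤ H, Nat.card M = p ^ n := by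
        obtain ⟨M, h1, h2⟩ := Sylow.exists_subgroup_le_card_pow_prime_of_le_card hprime hP
          (H := H) (n := n) (by rw [hH]; exact Nat.pow_le_pow_right hprime.pos n.le_succ)
        exact ⟨M, h1, h2⟩
      rw [ih M hMH]
      have hidx : (M.subgroupOf H).index = p := by
        have h1 := (M.subgroupOf H).index_mul_card
        rw [Nat.card_congr (Subgroup.subgroupOfEquivOfLe hMc).toEquiv, hMH, hH, pow_succ'] at h1
        exact Nat.eq_of_mul_eq_mul_right (pow_pos hprime.pos n) h1
      have hnorm : (M.subgroupOf H).Normal := by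
        apply Subgroup.normal_of_index_eq_minFac_card
        rw [hidx, hH, hprime.pow_minFac (Nat.succ_ne_zero n)]
      obtain ⟨x, hxH, hxM⟩ : ∃ x ∈ H, x ∉ M := by
        by_contra! hcon
        have : M = H := le_antisymm hMc hcon
        rw [this, hH] at hMH
        exact absurd (Nat.pow_right_injective hprime.two_le hMH) (Nat.succ_ne_self n)
      have hxp : x ^ p ∈ M := by
        have := (M.subgroupOf H).pow_index_mem ⟨x, hxH⟩
        rw [hidx] at this
        exact this
      have hconj : ∀ m ∈ M, x⁻¹ * m * x ∈ M := by
        intro m hm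
        have := hnorm.conj_mem' ⟨m, hMc hm⟩ hm ⟨x, hxH⟩
        exact this
      -- No subgroup lies strictly between `M` and `H`, so the stabilizer in `H` is all of `H`.
      have hfix : ∀ y : Y, (∀ m ∈ M, m • y = y) → x • y = y → ∀ h ∈ H, h • y = y := by
        intro y hM hx
        set S := MulAction.stabilizer P y ⊓ H
        have hMS : M ≤ S := le_inf (fun m hm => hM m hm) hMc
        have hSH : S ≤ H := inf_le_right
        have h1 := Subgroup.card_dvd_of_le hMS
        have h2 := Subgroup.card_dvd_of_le hSH
        rw [hH] at h2
        obtain ⟨k, hk, hk'⟩ := (Nat.dvd_prime_pow hprime).1 h2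
        rw [hk', hMH] at h1
        have h3 := (Nat.pow_dvd_pow_iff_le_right hprime.one_lt).1 h1
        have h4 : k = n + 1 := by
          rcases Nat.lt_or_ge n k with h | h
          · omega
          · exfalso
            have hkn : k = n := le_antisymm h h3
            have : M = S := Subgroup.eq_of_le_of_card_ge hMS (by rw [hk', hMH, hkn])
            exact hxM (this ▸ ⟨hx, hxH⟩)
        have : S = H := Subgroup.eq_of_le_of_card_ge hSH (by rw [hk', h4, hH])
        intro h hh
        rw [← this] at hh
        exact hh.1
      have hsub : (Finset.univ.filter fun y : Y => ∀ h ∈ H, h • y = y) ⊆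
          Finset.univ.filter fun y : Y => ∀ h ∈ M, h • y = y := by
        intro y
        simp only [Finset.mem_filter, Finset.mem_univ, true_and]
        exact fun h m hm => h m (hMc hm)
      have hpow : ∀ (i : ℕ) (y : Y), (x • · : Y → Y)^[i] y = x ^ i • y := fun i y => by
        rw [smul_iterate_apply]
      -- Since `x ^ p ∈ M`, the points fixed by `M` but not by `H` form `x`-cycles of length `p`.
      rw [← Finset.sum_sdiff hsub, add_eq_right]
      refine sum_eq_zero_of_iterate_prime (p := p) (x • ·) f _ ?_ ?_ ?_ ?_
      · intro y
        simp only [Finset.mem_sdiff, Finset.mem_filter, Finset.mem_univ, true_and]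
        rintro ⟨h1, h2⟩
        refine ⟨fun m hm => ?_, fun h => h2 ?_⟩
        · have := h1 _ (hconj m hm)
          rw [mul_smul, mul_smul, inv_smul_eq_iff] at this
          exact this
        · have h3 : x • y = y := smul_left_cancel x (h x hxH)
          rwa [h3] at h
      · intro y
        simp only [Finset.mem_sdiff, Finset.mem_filter, Finset.mem_univ, true_and]
        rintro ⟨h1, -⟩
        rw [hpow]
        exact h1 _ hxp
      · intro y
        simp only [Finset.mem_sdiff, Finset.mem_filter, Finset.mem_univ, true_and]
        rintro ⟨h1, h2⟩ h3
        exact h2 (hfix y h1 h3)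
      · intro y _
        have : ∀ i, f ((x • · : Y → Y)^[i] y) = (ρ x ^ i) (f y) := fun i => by
          rw [hpow, hf, map_pow]
        simp_rw [this]
        exact geom_sum_apply_eq_zero (ρ x) (hρ x) (f y) (hpf y)
  obtain ⟨n, hn⟩ := IsPGroup.iff_card.1 hP
  have := key n ⊤ (by rw [Subgroup.card_top, hn])
  simpa using this

/-- Let `G` act on an abelian `p`-group `W` of finite exponent such that `(x - 1) ^ (p - 1) = 0`
for all `x` in a Sylow `p`-subgroup `P`. Then each fixed point of the normalizer of `P` is a fixed
point of `G`. -/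
theorem Sylow.apply_eq_self_of_normalizer {G W : Type*} [Group G] [Finite G] [AddCommGroup W]
    {p : ℕ} [Fact p.Prime] (P : Sylow p G) (ρ : G →* AddMonoid.End W)
    (hρ : ∀ x ∈ P, (ρ x - 1) ^ (p - 1) = 0) (k : ℕ) (w : W) (hk : p ^ k • w = 0)
    (hw : ∀ g ∈ Subgroup.normalizer (P : Set G), ρ g w = w) (g : G) : ρ g w = w := by
  classical
  induction k generalizing w g with
  | zero =>
    rw [pow_zero, one_smul] at hk
    rw [hk, map_zero]
  | succ k ih =>
    have hpw : ∀ g, ρ g (p • w) = p • w := fun g =>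
      ih (p • w) (by rw [← mul_smul, ← pow_succ, hk])
        (fun h hh => by rw [map_nsmul, hw h hh]) g
    have := Fintype.ofFinite (Sylow p G)
    choose t ht using fun S : Sylow p G => MulAction.exists_smul_eq G P S
    have hmul : ∀ g h w, ρ (g * h) w = ρ g (ρ h w) := fun g h w => by rw [map_mul]; rfl
    -- The value does not depend on the choice of `t S`, because the normalizer fixes `w`.
    have hval : ∀ g S, g • P = S → ρ g w = ρ (t S) w := by
      intro g S hgS
      have h1 : (t S)⁻¹ * g ∈ Subgroup.normalizer (P : Set G) := by
        rw [← Sylow.smul_eq_iff_mem_normalizer, mul_smul, hgS, inv_smul_eq_iff, ht]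
      have h2 := hw _ h1
      rw [← mul_inv_cancel_left (t S) g, hmul, h2]
    have hequiv : ∀ g S, ρ (t (g • S)) w = ρ g (ρ (t S) w) := fun g S => by
      rw [← hmul, hval (g * t S) (g • S) (by rw [mul_smul, ht])]
    have hPN : ∀ x ∈ P, ρ x w = w := fun x hx => hw x (Subgroup.le_normalizer hx)
    have hzero : ∑ S, (ρ (t S) w - w) = 0 := by
      rw [IsPGroup.sum_eq_sum_fixedPoints (P := P) (p := p) P.isPGroup'
        (ρ.comp (P : Subgroup G).subtype) (fun x => hρ x x.2)]
      · refine Finset.sum_eq_zero fun S hS => ?_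
        have h1 : (P : Subgroup G) ≤ S := by
          rw [← P.isPGroup'.sylow_mem_fixedPoints_iff]
          simpa using hS
        have h2 : S = P := Sylow.ext (P.is_maximal' S.isPGroup' h1)
        rw [← hval 1 S (by rw [one_smul, h2]), map_one]
        exact sub_self w
      · intro x S
        change ρ (t ((x : G) • S)) w - w = ρ x (ρ (t S) w - w)
        rw [hequiv, map_sub, hPN x x.2]
      · intro S
        rw [smul_sub, ← map_nsmul, hpw, sub_self]
    have hsum : ∑ S, ρ (t S) w = Nat.card (Sylow p G) • w := by
      rw [Finset.sum_sub_distrib, sub_eq_zero] at hzero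
      rw [hzero, Finset.sum_const, Finset.card_univ, Nat.card_eq_fintype_card]
    have hfix : Nat.card (Sylow p G) • (ρ g w - w) = 0 := by
      rw [smul_sub, ← map_nsmul, ← hsum, map_sum, sub_eq_zero]
      simp_rw [← hequiv]
      exact Equiv.sum_comp (MulAction.toPerm g : Equiv.Perm (Sylow p G)) fun S => ρ (t S) w
    have hpfix : p • (ρ g w - w) = 0 := by rw [smul_sub, ← map_nsmul, hpw, sub_self]
    have hcop : Nat.Coprime (Nat.card (Sylow p G)) p :=
      Nat.Coprime.symm ((Nat.Prime.coprime_iff_not_dvd Fact.out).2 (not_dvd_card_sylow p G))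
    rw [← sub_eq_zero, ← AddMonoid.addOrderOf_eq_one_iff, ← Nat.dvd_one, ← hcop.gcd_eq_one]
    exact Nat.dvd_gcd (addOrderOf_dvd_of_nsmul_eq_zero hfix) (addOrderOf_dvd_of_nsmul_eq_zero hpfix)

/-- Let `G` act from the right on an abelian `p`-group `V` of finite exponent such that
`(x - 1) ^ (p - 1) = 0` for all `x` in a Sylow `p`-subgroup `P`. Then `[V, G]` is contained in
`[V, N_G(P)]`. -/
theorem Sylow.sub_mem_closure_of_normalizer {G V : Type*} [Group G] [Finite G] [AddCommGroup V]
    {p : ℕ} [Fact p.Prime] (P : Sylow p G) (τ : G → AddMonoid.End V) (hone : τ 1 = 1)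
    (hmul : ∀ g h, τ (g * h) = τ h * τ g) (hτ : ∀ x ∈ P, (τ x - 1) ^ (p - 1) = 0)
    (k : ℕ) (hk : ∀ v : V, p ^ k • v = 0) (g : G) (v : V) :
    τ g v - v ∈ AddSubgroup.closure
      {b | ∃ v, ∃ h ∈ Subgroup.normalizer (P : Set G), b = τ h v - v} := by
  set S := AddSubgroup.closure
      {b | ∃ v, ∃ h ∈ Subgroup.normalizer (P : Set G), b = τ h v - v}
  -- Precomposition turns the right action on `V` into a left action on its characters.
  let ρ : G →* AddMonoid.End (V →+ AddCircle (1 : ℚ)) :=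
    { toFun := fun g =>
        { toFun := fun w => w.comp (τ g)
          map_zero' := rfl
          map_add' := fun _ _ => rfl }
      map_one' := by
        ext w v
        change w (τ 1 v) = w v
        rw [hone]
        rfl
      map_mul' := fun g h => by
        ext w v
        change w (τ (g * h) v) = w (τ h (τ g v))
        rw [hmul]
        rfl }
  have hρ : ∀ g w v, ρ g w v = w (τ g v) := fun _ _ _ => rfl
  have hpow : ∀ (x : G) (n : ℕ) (w : V →+ AddCircle (1 : ℚ)) (v : V), ((ρ x - 1) ^ n) w v = w (((τ x - 1) ^ n) v) := by
    intro x n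
    induction n with
    | zero => intro w v; rfl
    | succ n ih =>
      intro w v
      rw [pow_succ, pow_succ']
      change ((ρ x - 1) ^ n) ((ρ x - 1) w) v = w ((τ x - 1) (((τ x - 1) ^ n) v))
      rw [ih]
      change w (τ x _) - w _ = w (τ x _ - _)
      exact (map_sub w _ _).symm
  rw [← QuotientAddGroup.eq_zero_iff]
  -- Characters separate the points of `V ⧸ S`, and their pullbacks to `V` are fixed by the
  -- normalizer.
  apply CharacterModule.eq_zero_of_character_apply
  intro χ
  let w : V →+ AddCircle (1 : ℚ) := AddMonoidHom.comp χ (QuotientAddGroup.mk' S)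
  have hw := P.apply_eq_self_of_normalizer ρ
    (fun x hx => by
      ext w v
      rw [hpow, hτ x hx]
      exact map_zero w) k w
    (by
      ext v
      change p ^ k • w v = 0
      rw [← map_nsmul, hk, map_zero])
    (fun h hh => by
      ext v
      rw [hρ, ← sub_eq_zero, ← map_sub]
      change χ ((τ h v - v : V) : V ⧸ S) = 0
      have hmem : τ h v - v ∈ S := AddSubgroup.subset_closure ⟨v, h, hh, rfl⟩
      rw [(QuotientAddGroup.eq_zero_iff _).2 hmem, map_zero]) g
  have := DFunLike.congr_fun hw v
  rw [hρ, ← sub_eq_zero, ← map_sub] at this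
  exact this

/-! ### Commutator filtrations. -/

open scoped commutatorElement

theorem Subgroup.commutator_commutator_le_of_rotate {G : Type*} [Group G] {H₁ H₂ H₃ N : Subgroup G}
    [N.Normal] (h1 : ⁅⁅H₂, H₃⁆, H₁⁆ ≤ N) (h2 : ⁅⁅H₃, H₁⁆, H₂⁆ ≤ N) : ⁅⁅H₁, H₂⁆, H₃⁆ ≤ N := by
  have key : ∀ H : Subgroup G, H ≤ N ↔ H.map (QuotientGroup.mk' N) = ⊥ := fun H => by
    rw [Subgroup.map_eq_bot_iff, QuotientGroup.ker_mk']
  rw [key, Subgroup.map_commutator, Subgroup.map_commutator] at *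
  exact Subgroup.commutator_commutator_eq_bot_of_rotate h1 h2

/-- Three subgroups lemma and induction on `j`. The series starts at index `0`, whence the `+ 1`. -/
theorem Subgroup.commutator_lowerCentralSeries_le {G : Type*} [Group G] (i j : ℕ) :
    ⁅(⊤ : Subgroup G).lowerCentralSeries i, (⊤ : Subgroup G).lowerCentralSeries j⁆ ≤
      (⊤ : Subgroup G).lowerCentralSeries (i + j + 1) := by
  induction j generalizing i with
  | zero => exact le_rfl
  | succ j ih =>
    rw [Subgroup.commutator_comm, Subgroup.lowerCentralSeries_succ]
    apply Subgroup.commutator_commutator_le_of_rotate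
    · rw [Subgroup.commutator_comm ⊤, ← Subgroup.lowerCentralSeries_succ]
      exact (ih (i + 1)).trans (le_of_eq (by congr 1; omega))
    · exact Subgroup.commutator_mono (ih i) le_rfl

/-- The subgroup generated by the commutators of elements of `E i` and `E j` with `n ≤ i + j`. -/
def commutatorFiltration {F : Type*} [Group F] (E : ℕ → Subgroup F) (n : ℕ) : Subgroup F :=
  Subgroup.closure {w | ∃ i j u v, n ≤ i + j ∧ u ∈ E i ∧ v ∈ E j ∧ ⁅u, v⁆ = w}

section commutatorFiltration

variable {F : Type*} [Group F] {E : ℕ → Subgroup F}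

theorem commutator_mem_commutatorFiltration {n i j : ℕ} (h : n ≤ i + j) {u v : F} (hu : u ∈ E i)
    (hv : v ∈ E j) : ⁅u, v⁆ ∈ commutatorFiltration E n :=
  Subgroup.subset_closure ⟨i, j, u, v, h, hu, hv, rfl⟩

theorem commutatorFiltration_normal (hE : ∀ i, (E i).Normal) (n : ℕ) :
    (commutatorFiltration E n).Normal := by
  refine ⟨fun w hw g => ?_⟩
  induction hw using Subgroup.closure_induction with
  | mem w hw =>
    obtain ⟨i, j, u, v, h, hu, hv, rfl⟩ := hw
    have : g * ⁅u, v⁆ * g⁻¹ = ⁅g * u * g⁻¹, g * v * g⁻¹⁆ := by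
      simp only [commutatorElement_def]; group
    rw [this]
    exact commutator_mem_commutatorFiltration h ((hE i).conj_mem u hu g) ((hE j).conj_mem v hv g)
  | one => simp
  | mul a b _ _ ha hb =>
    rw [show g * (a * b) * g⁻¹ = (g * a * g⁻¹) * (g * b * g⁻¹) by group]
    exact mul_mem ha hb
  | inv a _ ha =>
    rw [show g * a⁻¹ * g⁻¹ = (g * a * g⁻¹)⁻¹ by group]
    exact inv_mem ha

theorem commutator_le_commutatorFiltration_zero (h : E 0 = ⊤) :
    commutator F ≤ commutatorFiltration E 0 := by
  rw [commutator_eq_closure, Subgroup.closure_le]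
  rintro _ ⟨u, v, rfl⟩
  exact commutator_mem_commutatorFiltration (i := 0) (j := 0) le_rfl (by simp [h]) (by simp [h])

theorem commutatorElement_mul_mul_of_commute {G : Type*} [Group G] {u e v f : G}
    (h1 : Commute e (v * f)) (h2 : Commute u f) : ⁅u * e, v * f⁆ = ⁅u, v⁆ := by
  have h3 : ⁅u * e, v * f⁆ = u * (e * (v * f)) * e⁻¹ * u⁻¹ * (v * f)⁻¹ := by
    rw [commutatorElement_def]; group
  rw [h3, h1.eq, commutatorElement_def]
  have h4 : u * (v * f * e) * e⁻¹ * u⁻¹ * (v * f)⁻¹ = u * v * (f * u⁻¹) * f⁻¹ * v⁻¹ := by group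
  rw [h4, ← h2.inv_left.eq]
  group

/-- Write `ξ u = u * e` and `ξ v = v * f` with `e`, `f` one degree deeper. Modulo degree `n + 1`,
`e` commutes with `ξ v` and `u` with `f`, so `⁅u, v⁆` is unchanged. -/
theorem apply_mul_inv_mem_commutatorFiltration (hE : ∀ i, (E i).Normal) (hanti : Antitone E)
    (ξ : F →* F) (hξ : ∀ i, ∀ u ∈ E i, u⁻¹ * ξ u ∈ E (i + 1)) {n : ℕ} {w : F}
    (hw : w ∈ commutatorFiltration E n) : ξ w * w⁻¹ ∈ commutatorFiltration E (n + 1) := by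
  have hN := commutatorFiltration_normal hE (n + 1)
  set D := commutatorFiltration E (n + 1)
  have hcomm : ∀ u v : F, ⁅u, v⁆ ∈ D → Commute (u : F ⧸ D) (v : F ⧸ D) := by
    intro u v h
    rw [← QuotientGroup.eq_one_iff] at h
    exact commutatorElement_eq_one_iff_commute.1 h
  have hle : commutatorFiltration E n ≤
      ((QuotientGroup.mk' D).comp ξ).eqLocus (QuotientGroup.mk' D) := by
    rw [commutatorFiltration, Subgroup.closure_le]
    rintro _ ⟨i, j, u, v, h, hu, hv, rfl⟩
    have hv' : ξ v ∈ E j := by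
      have := mul_mem hv (hanti j.le_succ (hξ j v hv))
      rwa [mul_inv_cancel_left] at this
    have h1 := hcomm (u⁻¹ * ξ u) (ξ v)
      (commutator_mem_commutatorFiltration (by omega) (hξ i u hu) hv')
    have h2 := hcomm u (v⁻¹ * ξ v)
      (commutator_mem_commutatorFiltration (by omega) hu (hξ j v hv))
    have h3 := commutatorElement_mul_mul_of_commute (u := (u : F ⧸ D))
      (e := ((u⁻¹ * ξ u : F) : F ⧸ D)) (v := (v : F ⧸ D)) (f := ((v⁻¹ * ξ v : F) : F ⧸ D))
      (by rw [← QuotientGroup.mk_mul, mul_inv_cancel_left]; exact h1) h2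
    rw [← QuotientGroup.mk_mul, ← QuotientGroup.mk_mul, mul_inv_cancel_left,
      mul_inv_cancel_left] at h3
    change QuotientGroup.mk' D (ξ ⁅u, v⁆) = QuotientGroup.mk' D ⁅u, v⁆
    rw [map_commutatorElement, map_commutatorElement, map_commutatorElement]
    exact h3
  have := hle hw
  rw [← QuotientGroup.eq_one_iff, QuotientGroup.mk_mul, QuotientGroup.mk_inv, mul_inv_eq_one]
  exact this

end commutatorFiltration

/-! ### Primitives of inflated cocycles. -/

/-- The function `a ↦ f (ξ a) - f a`. -/
def twistSub {α A : Type*} [AddCommGroup A] (ξ : α → α) (f : α → A) : α → A :=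
  fun a => f (ξ a) - f a

/-- `s` exhibits the inflation of `c` along `π` as a coboundary. -/
def IsPrimitive {F Q A : Type*} [Group F] [Group Q] [AddCommGroup A] (π : F →* Q)
    (c : Q × Q → A) (s : F → A) : Prop :=
  ∀ u v, s (u * v) = s u + s v + c (π u, π v)

/-- A `2`-cochain that is symmetric on commuting pairs. -/
def IsSymmOnCommute {Q A : Type*} [Group Q] (c : Q × Q → A) : Prop :=
  ∀ a b, Commute a b → c (a, b) = c (b, a)

theorem IsSymmOnCommute.twistSub {Q A : Type*} [Group Q] [AddCommGroup A] {c : Q × Q → A}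
    (hc : IsSymmOnCommute c) (X : Q →* Q) : IsSymmOnCommute (twistSub (Prod.map X X) c) := by
  intro a b h
  simp only [_root_.twistSub, Prod.map_apply]
  rw [hc a b h, hc _ _ (h.map X)]

section IsPrimitive

variable {F Q A : Type*} [Group F] [Group Q] [AddCommGroup A] {π : F →* Q} {c : Q × Q → A}
  {s : F → A}

theorem IsPrimitive.cocycle_one_map (hs : IsPrimitive π c s) (u : F) : c (1, π u) = - s 1 := by
  have := hs 1 u
  rw [one_mul, map_one, add_right_comm] at this
  rw [eq_neg_iff_add_eq_zero, add_comm]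
  exact left_eq_add.1 (by rw [add_comm]; exact this)

/-- Thus `s - s 1` is a homomorphism on `ker π`; the term `s 1` appears because `c` need not be
normalized. -/
theorem IsPrimitive.mul_of_map_eq_one (hs : IsPrimitive π c s) {r : F} (hr : π r = 1) (u : F) :
    s (r * u) = s r + s u - s 1 := by
  rw [hs, hr, hs.cocycle_one_map, sub_eq_add_neg]

theorem IsPrimitive.twistSub (hs : IsPrimitive π c s) {X : Q →* Q} {ξ : F →* F}
    (hξ : ∀ u, π (ξ u) = X (π u)) :
    IsPrimitive π (twistSub (Prod.map X X) c) (twistSub ξ s) := by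
  intro u v
  simp only [_root_.twistSub, Prod.map_apply, map_mul, hs _ _, hξ]
  abel

theorem IsPrimitive.iterate_twistSub (hs : IsPrimitive π c s) {X : Q →* Q} {ξ : F →* F}
    (hξ : ∀ u, π (ξ u) = X (π u)) (k : ℕ) :
    IsPrimitive π ((_root_.twistSub (Prod.map X X))^[k] c) ((_root_.twistSub ξ)^[k] s) := by
  induction k with
  | zero => exact hs
  | succ k ih =>
    rw [Function.iterate_succ_apply', Function.iterate_succ_apply']
    exact ih.twistSub hξ

/-- Compare `s (u * v)` with `s (v * u)`, using `u * v = ⁅u, v⁆ * (v * u)`. -/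
theorem IsPrimitive.commutatorElement (hs : IsPrimitive π c s) (hc : IsSymmOnCommute c) {u v : F}
    (h : Commute (π u) (π v)) : s ⁅u, v⁆ = s 1 := by
  have h1 : π ⁅u, v⁆ = 1 := by rw [map_commutatorElement]; exact h.commutator_eq
  have h2 := hs.mul_of_map_eq_one h1 (v * u)
  rw [show ⁅u, v⁆ * (v * u) = u * v by rw [commutatorElement_def]; group, hs, hs, hc _ _ h] at h2
  have h3 : s ⁅u, v⁆ - s 1 = (s u + s v + c (π v, π u)) - (s v + s u + c (π v, π u)) := by
    rw [h2]; abel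
  rw [← sub_eq_zero, h3]
  abel

theorem IsPrimitive.eq_of_mem_commutatorFiltration (hs : IsPrimitive π c s)
    (hc : IsSymmOnCommute c) {E : ℕ → Subgroup F} {m : ℕ}
    (hm : ∀ i j u v, m ≤ i + j → u ∈ E i → v ∈ E j → Commute (π u) (π v)) {r : F}
    (hr : r ∈ commutatorFiltration E m) : s r = s 1 := by
  suffices π r = 1 ∧ s r = s 1 from this.2
  induction hr using Subgroup.closure_induction with
  | mem w hw =>
    obtain ⟨i, j, u, v, h, hu, hv, rfl⟩ := hw
    have h' := hm i j u v h hu hv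
    exact ⟨by rw [map_commutatorElement]; exact h'.commutator_eq, hs.commutatorElement hc h'⟩
  | one => simp
  | mul a b _ _ ha hb =>
    refine ⟨by rw [map_mul, ha.1, hb.1, one_mul], ?_⟩
    rw [hs.mul_of_map_eq_one ha.1, ha.2, hb.2, add_sub_cancel_right]
  | inv a _ ha =>
    refine ⟨by rw [map_inv, ha.1, inv_one], ?_⟩
    have := hs.mul_of_map_eq_one ha.1 a⁻¹
    rw [mul_inv_cancel, ha.2, add_sub_cancel_left] at this
    exact this.symm

/-- For `g` the `k`-th iterate, `g (ξ r) - g r = g (ξ r * r⁻¹) - g 1`, and `ξ r * r⁻¹` lies one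
degree deeper: one twist is traded for one degree. -/
theorem IsPrimitive.iterate_eq_of_mem_commutatorFiltration (hs : IsPrimitive π c s)
    (hc : IsSymmOnCommute c) {X : Q →* Q} {ξ : F →* F} (hπ : ∀ u, π (ξ u) = X (π u))
    {E : ℕ → Subgroup F} (hE : ∀ i, (E i).Normal) (hanti : Antitone E)
    (hξ : ∀ i, ∀ u ∈ E i, u⁻¹ * ξ u ∈ E (i + 1)) {m : ℕ}
    (hm : ∀ i j u v, m ≤ i + j → u ∈ E i → v ∈ E j → Commute (π u) (π v))
    {n k : ℕ} (hnk : n + k = m) {r : F} (hr : r ∈ commutatorFiltration E n) (hr1 : π r = 1) :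
    ((_root_.twistSub ξ)^[k] s) r = ((_root_.twistSub ξ)^[k] s) 1 := by
  induction k generalizing n r with
  | zero => exact hs.eq_of_mem_commutatorFiltration hc (by rwa [← hnk] at hm) hr
  | succ k ih =>
    have h1 : π (ξ r * r⁻¹) = 1 := by rw [map_mul, hπ, map_inv, hr1, map_one, inv_one, one_mul]
    have h2 := ih (by omega) (apply_mul_inv_mem_commutatorFiltration hE hanti ξ hξ hr) h1
    have h3 := (hs.iterate_twistSub hπ k).mul_of_map_eq_one h1 r
    rw [inv_mul_cancel_right, h2, add_sub_cancel_left] at h3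
    rw [Function.iterate_succ_apply', _root_.twistSub, _root_.twistSub, h3, map_one, sub_self,
      sub_self]

end IsPrimitive

/-- A homomorphism from a subgroup `R` to a divisible group that vanishes on `R ∩ [G, G]` extends
to `G`. -/
theorem exists_extension_of_divisible {G A : Type*} [Group G] [AddCommGroup A] [DivisibleBy A ℤ]
    (R : Subgroup G) (φ : R →* Multiplicative A) (hφ : ∀ r : R, (r : G) ∈ commutator G → φ r = 1) :
    ∃ χ : G →* Multiplicative A, ∀ r : R, χ r = φ r := by
  let g : R →* Abelianization G := Abelianization.of.comp R.subtype
  have hker : g.ker ≤ φ.ker := by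
    intro r hr
    apply hφ
    rw [← Abelianization.ker_of]
    exact hr
  let ψ : g.range →* Multiplicative A :=
    g.rangeRestrict.liftOfSurjective g.rangeRestrict_surjective ⟨φ, by
      rwa [MonoidHom.ker_rangeRestrict]⟩
  have hψ : ∀ r, ψ (g.rangeRestrict r) = φ r := fun r =>
    MonoidHom.liftOfRightInverse_comp_apply _ _ _ _ r
  -- Divisible groups are injective, so the map on the image of `R` extends to the abelianization.
  obtain ⟨h, hh⟩ := (Module.Baer.of_divisible A).extension_property_addMonoidHom
    (MonoidHom.toAdditive g.range.subtype) (by exact g.range.subtype_injective)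
    (MonoidHom.toAdditive ψ)
  refine ⟨(MonoidHom.toAdditive.symm h).comp Abelianization.of, fun r => ?_⟩
  have := DFunLike.congr_fun hh (Additive.ofMul (g.rangeRestrict r))
  rw [← hψ]
  exact this

/-- Extend `s - s 1` from `ker π` to a homomorphism `χ` on `F`; then `χ - s` is constant on the
fibres of `π` and descends to `β`. -/
theorem IsPrimitive.exists_eq_coboundary {F Q A : Type*} [Group F] [Group Q] [AddCommGroup A]
    [DivisibleBy A ℤ] {π : F →* Q} (hπ : Function.Surjective π) {c : Q × Q → A} {s : F → A}
    (hs : IsPrimitive π c s) (h : ∀ r ∈ commutator F, π r = 1 → s r = s 1) :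
    ∃ β : Q → A, ∀ a b, c (a, b) = β b - β (a * b) + β a := by
  let φ : π.ker →* Multiplicative A :=
    { toFun := fun r => Multiplicative.ofAdd (s r - s 1)
      map_one' := by simp
      map_mul' := fun r r' => by
        rw [← ofAdd_add, Subgroup.coe_mul, hs.mul_of_map_eq_one r.2]
        congr 1
        abel }
  obtain ⟨χ, hχ⟩ := exists_extension_of_divisible π.ker φ fun r hr => by
    change Multiplicative.ofAdd (s r - s 1) = 1
    rw [h r hr r.2, sub_self, ofAdd_zero]
  obtain ⟨t, ht⟩ := hπ.hasRightInverse
  have hmul : ∀ u v, (χ (u * v)).toAdd = (χ u).toAdd + (χ v).toAdd := fun u v => by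
    rw [map_mul, toAdd_mul]
  have hker : ∀ r, π r = 1 → (χ r).toAdd = s r - s 1 := fun r hr =>
    congrArg Multiplicative.toAdd (hχ ⟨r, hr⟩)
  have hconst : ∀ u v, π u = π v → (χ u).toAdd - s u = (χ v).toAdd - s v := by
    intro u v huv
    have h1 : π (u * v⁻¹) = 1 := by rw [map_mul, map_inv, huv, mul_inv_cancel]
    have h2 := hs.mul_of_map_eq_one h1 v
    have h3 := hmul (u * v⁻¹) v
    rw [inv_mul_cancel_right] at h2 h3
    rw [h3, h2, hker _ h1]
    abel
  refine ⟨fun q => (χ (t q)).toAdd - s (t q), fun a b => ?_⟩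
  have h1 := hconst (t (a * b)) (t a * t b) (by rw [map_mul, ht, ht, ht])
  have h2 := hs (t a) (t b)
  rw [ht, ht] at h2
  simp only
  rw [h1, hmul, h2]
  abel

/-- The permutation `σ q` is left multiplication by `(0, q)` in the extension `A × Q` defined by
`c`. A word `u` then acts with a translation part `s u`, which is the primitive. -/
theorem exists_isPrimitive_freeGroup_lift {Q A : Type*} [Group Q] [AddCommGroup A] (c : Q × Q → A)
    (hc : ∀ a b d, c (a * b, d) + c (a, b) = c (b, d) + c (a, b * d)) :
    ∃ s, IsPrimitive (FreeGroup.lift (id : Q → Q)) c s := by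
  set π := FreeGroup.lift (id : Q → Q)
  let σ : Q → Equiv.Perm (A × Q) := fun q =>
    { toFun := fun x => (x.1 + c (q, x.2), q * x.2)
      invFun := fun x => (x.1 - c (q, q⁻¹ * x.2), q⁻¹ * x.2)
      left_inv := fun x => by simp
      right_inv := fun x => by simp }
  have hone : ∀ q, c (1, q) = c (1, 1) := fun q => by
    have := hc 1 1 q
    rw [one_mul, one_mul, add_right_inj] at this
    exact this.symm
  have key : ∀ u, ∃ s, ∀ x, FreeGroup.lift σ u x = (x.1 + s + c (π u, x.2), π u * x.2) := by
    intro u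
    induction u using FreeGroup.induction_on with
    | C1 =>
      refine ⟨-c (1, 1), fun x => ?_⟩
      rw [map_one, map_one, hone x.2]
      simp
    | of q =>
      refine ⟨0, fun x => ?_⟩
      simp [π, σ]
    | inv_of q _ =>
      refine ⟨-c (1, 1) - c (q, q⁻¹), fun x => ?_⟩
      have h1 : π (FreeGroup.of q)⁻¹ = q⁻¹ := by simp [π]
      have h2 := hc q q⁻¹ x.2
      rw [mul_inv_cancel, hone] at h2
      rw [h1, map_inv, FreeGroup.lift_apply_of]
      change (x.1 - c (q, q⁻¹ * x.2), q⁻¹ * x.2) = _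
      ext
      · linear_combination (norm := module) (1 : ℤ) • h2
      · rfl
    | mul u v hu hv =>
      obtain ⟨s, hs⟩ := hu
      obtain ⟨t, ht⟩ := hv
      refine ⟨s + t + c (π u, π v), fun x => ?_⟩
      rw [map_mul, Equiv.Perm.mul_apply, ht, hs, map_mul, mul_assoc]
      have h2 := hc (π u) (π v) x.2
      ext
      · linear_combination (norm := module) (-1 : ℤ) • h2
      · rfl
  choose s hs using key
  refine ⟨s, fun u v => ?_⟩
  have h1 := hs (u * v) (0, 1)
  rw [map_mul, Equiv.Perm.mul_apply, hs v, hs u] at h1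
  have h2 := congrArg Prod.fst h1
  have h3 := hc (π u) (π v) 1
  simp only [map_mul, mul_one] at h2 h3
  linear_combination (norm := module) (-1 : ℤ) • h2 - (1 : ℤ) • h3

theorem exists_iterate_twistSub_eq_coboundary {Q A : Type*} [Group Q] [AddCommGroup A]
    [DivisibleBy A ℤ] (c : Q × Q → A)
    (hc : ∀ a b d, c (a * b, d) + c (a, b) = c (b, d) + c (a, b * d)) (hsymm : IsSymmOnCommute c)
    (X : Q →* Q) (E : ℕ → Subgroup Q) (hE : ∀ i, (E i).Normal) (hanti : Antitone E)
    (hE0 : E 0 = ⊤) (hX : ∀ i, ∀ q ∈ E i, q⁻¹ * X q ∈ E (i + 1)) (m : ℕ)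
    (hm : ∀ i j u v, m ≤ i + j → u ∈ E i → v ∈ E j → Commute u v) :
    ∃ β : Q → A, ∀ a b,
      ((twistSub (Prod.map X X))^[m] c) (a, b) = β b - β (a * b) + β a := by
  obtain ⟨s, hs⟩ := exists_isPrimitive_freeGroup_lift c hc
  have hπX : ∀ u, FreeGroup.lift (id : Q → Q) (FreeGroup.map X u) =
      X (FreeGroup.lift (id : Q → Q) u) := fun u => by
    have : (FreeGroup.lift (id : Q → Q)).comp (FreeGroup.map X) =
        X.comp (FreeGroup.lift (id : Q → Q)) := by
      ext q
      simp
    exact DFunLike.congr_fun this u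
  refine (hs.iterate_twistSub hπX m).exists_eq_coboundary
    (fun q => ⟨FreeGroup.of q, by simp⟩) fun r hr hr1 => ?_
  refine hs.iterate_eq_of_mem_commutatorFiltration hsymm hπX
    (E := fun i => (E i).comap (FreeGroup.lift (id : Q → Q))) (fun i => (hE i).comap _)
    (fun i j hij => Subgroup.comap_mono (hanti hij)) ?_ ?_ (zero_add m)
    (commutator_le_commutatorFiltration_zero (by simp [hE0]) hr) hr1
  · intro i u hu
    rw [Subgroup.mem_comap, map_mul, map_inv, hπX]
    exact hX i _ hu
  · intro i j u v h hu hv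
    exact hm i j _ _ h hu hv

/-! ### The conjugation action on Ш². -/

namespace BogomolovMultiplier

open groupCohomology

theorem mem_cocycles₂_ratModInt_iff {Q : Type u} [Group Q]
    (c : Q × Q → ULift.{u} (AddCircle (1 : ℚ))) :
    c ∈ cocycles₂ (ratModInt Q) ↔
      ∀ a b d, c (a * b, d) + c (a, b) = c (b, d) + c (a, b * d) :=
  mem_cocycles₂_iff (A := ratModInt Q) c

theorem H2π_ratModInt_eq_zero_iff {Q : Type u} [Group Q] (c : cocycles₂ (ratModInt Q)) :
    H2π (ratModInt Q) c = 0 ↔ ∃ β : Q → ULift.{u} (AddCircle (1 : ℚ)),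
      ∀ a b, c (a, b) = β b - β (a * b) + β a := by
  rw [H2π_eq_zero_iff]
  constructor
  · rintro ⟨β, hβ⟩
    exact ⟨β, fun a b => (congrFun hβ (a, b)).symm⟩
  · rintro ⟨β, hβ⟩
    exact ⟨β, funext fun x => (hβ x.1 x.2).symm⟩

theorem map_subtype_H2π_eq_zero_iff {Q : Type u} [Group Q] (A : Subgroup Q)
    (c : cocycles₂ (ratModInt Q)) :
    (groupCohomology.map A.subtype (𝟙 (Rep.res A.subtype (ratModInt Q))) 2).hom
        (H2π (ratModInt Q) c) = 0 ↔
      ∃ β : A → ULift.{u} (AddCircle (1 : ℚ)), ∀ a b : A, c (a, b) = β b - β (a * b) + β a := by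
  have h := H2π_comp_map_apply A.subtype (𝟙 (Rep.res A.subtype (ratModInt Q))) c
  rw [h]
  exact H2π_ratModInt_eq_zero_iff (Q := A) _

theorem H2π_mem_sha_iff {Q : Type u} [Group Q] (c : cocycles₂ (ratModInt Q)) :
    H2π (ratModInt Q) c ∈ sha (ratModInt Q) 2 ↔ ∀ A : Subgroup Q, IsMulCommutative A →
      ∃ β : A → ULift.{u} (AddCircle (1 : ℚ)), ∀ a b : A, c (a, b) = β b - β (a * b) + β a := by
  simp only [sha, Submodule.mem_iInf, LinearMap.mem_ker]
  exact forall₂_congr fun A _ => map_subtype_H2π_eq_zero_iff A c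

/-- Restrict to the abelian subgroup generated by `a` and `b`, where a coboundary is symmetric. -/
theorem isSymmOnCommute_of_mem_sha {Q : Type u} [Group Q] {c : cocycles₂ (ratModInt Q)}
    (hc : H2π (ratModInt Q) c ∈ sha (ratModInt Q) 2) : IsSymmOnCommute c := by
  intro a b hab
  have hA : IsMulCommutative (Subgroup.closure {a, b}) := by
    apply Subgroup.isMulCommutative_closure
    rintro x (rfl | rfl) y (rfl | rfl)
    exacts [rfl, hab, hab.symm, rfl]
  obtain ⟨β, hβ⟩ := (H2π_mem_sha_iff c).1 hc _ hA
  let a' : Subgroup.closure {a, b} := ⟨a, Subgroup.subset_closure (by simp)⟩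
  let b' : Subgroup.closure {a, b} := ⟨b, Subgroup.subset_closure (by simp)⟩
  have h : a' * b' = b' * a' := Subtype.ext hab
  refine (hβ a' b').trans (Eq.trans ?_ (hβ b' a').symm)
  rw [h]
  abel

section conj

variable {G : Type u} [Group G] (Q : Subgroup G) [Q.Normal]

theorem exists_conj_H2π_eq (g : G) (c : cocycles₂ (ratModInt Q)) :
    ∃ d : cocycles₂ (ratModInt Q),
      (⇑d = fun x => c (MulAut.conjNormal g x.1, MulAut.conjNormal g x.2)) ∧
      conj Q g (H2π (ratModInt Q) c) = H2π (ratModInt Q) d :=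
  ⟨_, rfl, H2π_comp_map_apply (A := ratModInt Q) (B := ratModInt Q)
    (MulAut.conjNormal g : MulAut Q).toMonoidHom (𝟙 (ratModInt Q)) c⟩

theorem conj_one : conj Q 1 = LinearMap.id := by
  ext α
  induction α using H2_induction_on with
  | h c =>
    obtain ⟨d, hd, hd'⟩ := exists_conj_H2π_eq Q 1 c
    rw [hd', LinearMap.id_apply]
    congr 1
    ext a b
    simp [hd]

theorem conj_mul (g h : G) : conj Q (g * h) = conj Q h ∘ₗ conj Q g := by
  ext α
  induction α using H2_induction_on with
  | h c =>
    obtain ⟨d, hd, hd'⟩ := exists_conj_H2π_eq Q g c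
    obtain ⟨e, he, he'⟩ := exists_conj_H2π_eq Q h d
    obtain ⟨f, hf, hf'⟩ := exists_conj_H2π_eq Q (g * h) c
    rw [LinearMap.comp_apply, hd', he', hf']
    congr 1
    ext a b
    simp [hd, he, hf]

theorem conj_mem_sha (g : G) {α : groupCohomology (ratModInt Q) 2}
    (hα : α ∈ sha (ratModInt Q) 2) : conj Q g α ∈ sha (ratModInt Q) 2 := by
  induction α using H2_induction_on with
  | h c =>
    obtain ⟨d, hd, hd'⟩ := exists_conj_H2π_eq Q g c
    rw [hd', H2π_mem_sha_iff]
    intro A hA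
    obtain ⟨β, hβ⟩ := (H2π_mem_sha_iff c).1 hα
      (A.map (MulAut.conjNormal g : MulAut Q).toMonoidHom) inferInstance
    refine ⟨fun a => β ⟨MulAut.conjNormal g a, Subgroup.mem_map_of_mem _ a.2⟩, fun a b => ?_⟩
    rw [hd]
    refine (hβ ⟨MulAut.conjNormal g a, Subgroup.mem_map_of_mem _ a.2⟩
      ⟨MulAut.conjNormal g b, Subgroup.mem_map_of_mem _ b.2⟩).trans ?_
    congr 3
    exact Subtype.ext (map_mul (MulAut.conjNormal g : MulAut Q) (a : Q) b).symm

/-- The restriction of `conj Q g` to `Ш²(Q, ℚ/ℤ)`. -/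
noncomputable def conjSha (g : G) : AddMonoid.End (sha (ratModInt Q) 2) :=
  ((conj Q g).restrict fun _ h => conj_mem_sha Q g h).toAddMonoidHom

theorem coe_conjSha (g : G) (α : sha (ratModInt Q) 2) :
    (conjSha Q g α : groupCohomology (ratModInt Q) 2) = conj Q g α := rfl

theorem exists_conjSha_sub_one_pow_eq (g : G) {c : cocycles₂ (ratModInt Q)}
    (hc : H2π (ratModInt Q) c ∈ sha (ratModInt Q) 2) (k : ℕ) :
    ∃ d : cocycles₂ (ratModInt Q),
      ⇑d = (twistSub (Prod.map (MulAut.conjNormal g : MulAut Q).toMonoidHom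
        (MulAut.conjNormal g : MulAut Q).toMonoidHom))^[k] c ∧
      ((((conjSha Q g - 1) ^ k) ⟨_, hc⟩ : sha (ratModInt Q) 2) :
        groupCohomology (ratModInt Q) 2) = H2π (ratModInt Q) d := by
  induction k with
  | zero => exact ⟨c, rfl, rfl⟩
  | succ k ih =>
    obtain ⟨d, hd, hd'⟩ := ih
    obtain ⟨e, he, he'⟩ := exists_conj_H2π_eq Q g d
    refine ⟨e - d, ?_, ?_⟩
    · rw [Function.iterate_succ_apply', ← hd]
      change ⇑e - ⇑d = _
      rw [he]
      rfl
    · rw [pow_succ']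
      change conj Q g ((((conjSha Q g - 1) ^ k) ⟨_, hc⟩ : sha (ratModInt Q) 2) :
        groupCohomology (ratModInt Q) 2) - _ = _
      rw [map_sub, ← he', ← hd']
      rfl

end conj

theorem card_smul_H2_eq_zero {Q : Type u} [Group Q] [Finite Q]
    (α : groupCohomology (ratModInt Q) 2) : Nat.card Q • α = 0 := by
  have := Fintype.ofFinite Q
  induction α using H2_induction_on with
  | h c =>
    rw [← map_nsmul, H2π_ratModInt_eq_zero_iff]
    -- Sum the cocycle identity over its last variable.
    refine ⟨fun x => ∑ z, c (x, z), fun a b => ?_⟩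
    have h := fun z => (mem_cocycles₂_ratModInt_iff c).1 c.2 a b z
    have h2 := Finset.sum_congr (rfl : (Finset.univ : Finset Q) = _) fun z _ => h z
    have h3 : ∑ z, c (a, b * z) = ∑ z, c (a, z) :=
      Equiv.sum_comp (Equiv.mulLeft b) fun z => c (a, z)
    rw [Finset.sum_add_distrib, Finset.sum_add_distrib, Finset.sum_const, Finset.card_univ,
      ← Nat.card_eq_fintype_card, h3] at h2
    refine (eq_sub_of_add_eq' h2).trans ?_
    abel

noncomputable instance : DivisibleBy (ULift.{u} (AddCircle (1 : ℚ))) ℤ where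
  div a n := ULift.up (DivisibleBy.div a.down n)
  div_zero a := congrArg ULift.up (DivisibleBy.div_zero a.down)
  div_cancel a hn := congrArg ULift.up (DivisibleBy.div_cancel a.down hn)

/-- The filtration of `Q` comes from the lower central series of `P`, not of `Q`: conjugation by `x
∈ P` then changes elements only by the next term, and terms `i`, `j` commute when `m ≤ i + j`. -/
theorem conjSha_sub_one_pow_eq_zero {G : Type u} [Group G] (Q : Subgroup G) [Q.Normal]
    (P : Subgroup G) (hQP : Q ≤ P) (m : ℕ)
    (hm : (⊤ : Subgroup P).lowerCentralSeries (m + 1) = ⊥) (x : G) (hx : x ∈ P) :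
    (conjSha Q x - 1) ^ m = 0 := by
  ext ⟨α, hα⟩
  induction α using H2_induction_on with
  | h c =>
    obtain ⟨d, hd, hd'⟩ := exists_conjSha_sub_one_pow_eq Q x hα m
    rw [hd']
    change _ = 0
    rw [H2π_ratModInt_eq_zero_iff, hd]
    refine exists_iterate_twistSub_eq_coboundary c ((mem_cocycles₂_ratModInt_iff c).1 c.2)
      (isSymmOnCommute_of_mem_sha hα) (MulAut.conjNormal x : MulAut Q).toMonoidHom
      (fun i => ((⊤ : Subgroup P).lowerCentralSeries i).comap (Subgroup.inclusion hQP))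
      (fun i => inferInstance)
      (fun i j hij => Subgroup.comap_mono (Subgroup.lowerCentralSeries_antitone _ hij))
      (by simp) ?_ m ?_
    · intro i q hq
      have h := Subgroup.commutator_mem_commutator
        (inv_mem (Subgroup.mem_comap.1 hq)) (Subgroup.mem_top (⟨x, hx⟩ : P))
      rw [Subgroup.mem_comap, Subgroup.lowerCentralSeries_succ]
      convert h using 1
      ext
      simp [commutatorElement_def, mul_assoc]
    · intro i j u v hij hu hv
      have h := Subgroup.commutator_lowerCentralSeries_le i j
        (Subgroup.commutator_mem_commutator (Subgroup.mem_comap.1 hu) (Subgroup.mem_comap.1 hv))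
      have h2 := Subgroup.lowerCentralSeries_antitone _ (Nat.succ_le_succ hij) h
      rw [Nat.succ_eq_add_one, hm, Subgroup.mem_bot, ← map_commutatorElement,
        map_eq_one_iff _ (Subgroup.inclusion_injective hQP)] at h2
      exact commutatorElement_eq_one_iff_commute.1 h2

end BogomolovMultiplier

/-! ### Conclusion. -/

theorem mainTheorem4 {G : Type u} [Group G] [Finite G] (p : ℕ) [Fact p.Prime] (P : Sylow p G)
    (hP : Group.nilpotencyClass P ≤ p) (Q : Subgroup G) [Q.Normal] (hQ : IsPGroup p Q) :
    BogomolovMultiplier.shaCommutator Q ⊤ =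
      BogomolovMultiplier.shaCommutator Q (Subgroup.normalizer (P : Set G)) := by
  open BogomolovMultiplier in
  refine le_antisymm ?_ (AddSubgroup.closure_mono fun β ⟨α, hα, g, _, h⟩ =>
    ⟨α, hα, g, Subgroup.mem_top g, h⟩)
  have hpos : 0 < p := (Fact.out : p.Prime).pos
  have : Group.IsNilpotent P := P.isPGroup'.isNilpotent
  have hlcs : (⊤ : Subgroup P).lowerCentralSeries (p - 1 + 1) = ⊥ := by
    rw [Nat.sub_add_cancel hpos]
    exact Subgroup.lowerCentralSeries_eq_bot_iff_nilpotencyClass_le.2 hP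
  obtain ⟨k, hk⟩ := IsPGroup.iff_card.1 hQ
  rw [shaCommutator, AddSubgroup.closure_le]
  rintro _ ⟨α, hα, g, -, rfl⟩
  have h := P.sub_mem_closure_of_normalizer (conjSha Q)
    (by ext α; rw [coe_conjSha, BogomolovMultiplier.conj_one]; rfl)
    (fun g h => by ext α; rw [coe_conjSha, BogomolovMultiplier.conj_mul]; rfl)
    (fun x hx => conjSha_sub_one_pow_eq_zero Q P (hQ.le_sylow_of_normal P) (p - 1) hlcs x hx)
    k (fun v => by
      ext
      rw [← hk]
      exact card_smul_H2_eq_zero _) g ⟨α, hα⟩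
  -- The closure was formed inside Ш²; push it forward to `H²`.
  have h2 := AddSubgroup.mem_map_of_mem (sha (ratModInt Q) 2).subtype.toAddMonoidHom h
  rw [AddMonoidHom.map_closure] at h2
  refine AddSubgroup.closure_mono ?_ h2
  rintro _ ⟨_, ⟨v, n, hn, rfl⟩, rfl⟩
  exact ⟨v, v.2, n, hn, rfl⟩
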